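/- A Dyck path $\pi$ of size $N$ is a lattice path from $(0,0)$ to $(N,N)$ with unit north and east steps that stays weakly above the line $x=y$; its area word $a_1\cdots a_N$ is defined by letting the $i$-th north step start on the line $y=x+a_i$. A partial labelling of $\pi$ is $w\in\mathbb N^N$ ($0\in\mathbb N$) with $w_1>0$ (if $N\ge 1$) and $w_i>w_{i-1}$ whenever $a_i>a_{i-1}$. A contractible valley is an index $2\le i\le N$ such that $a_i<a_{i-1}$, or $a_i=a_{i-1}$ and $w_i>w_{i-1}$. For integers $m,n,k$ let $\mathsf{LD}(m,n)^{\bullet k}$ be the set of triples $P=(\pi,w,dv)$ where $\pi$ is a Dyck path of size $m+n$, $w$ is a partial labelling of $\pi$ with exactly $m$ labels $0$ and $n$ positive labels, and $dv$ is a set of $k$ contractible valleys; it is empty if $m$, $n$ or $k$ is negative. Put $\mathsf{LD}(n)^{\bullet k}=\mathsf{LD}(0,n)^{\bullet k}$. Let $\mathsf{area}(P)=\sum_i a_i$; let $\mathsf{dinv}(P)$ be the number of pairs $i<j$ with $i\notin dv$ and either $a_i=a_j$, $w_i<w_j$ or $a_i=a_j+1$, $w_i>w_j$, minus $\# dv$;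 let $\mathsf{touch}(P)$ be the number of $i\notin dv$ with $a_i=0$ and $w_i>0$; and let $x^P=\prod_i x_{w_i}$ with $x_0=1$. Let $\binom{a}{b}_q=\frac{[a]_q!}{[b]_q!\,[a-b]_q!}$ for $0\le b\le a$, and $\binom{a}{b}_q=0$ otherwise. Let $m,n,k,r\in\mathbb N$ and let $M\ge 1$ be an integer, the maximal label. Then, over $\mathbb Q(q,t)$, $$\sum_{P}q^{\mathsf{dinv}(P)}t^{\mathsf{area}(P)}x^P\big|_{x_M=1} \quad\text{and}\quad \sum_{p=0}^m t^{m-p}\sum_{i=0}^p q^{\binom i2}\binom{r-p+i}{i}_q\binom{r}{p-i}_q\sum_{\substack{P\in\mathsf{LD}(m-p,n-m)^{\bullet k-i}\\ \mathsf{touch}(P)=r-p+i}}q^{\mathsf{dinv}(P)}t^{\mathsf{area}(P)}x^P$$ have the same coefficient at every monomial in the variables $x_1,\dots,x_{M-1}$, where the first sum is over all $P\in\mathsf{LD}(n)^{\bullet k}$ with $\mathsf{touch}(P)=r$, all labels at most $M$, and exactly $m$ labels equal to $M$. (As $M$ is arbitrary, every coefficient of the formal power series on the right is obtained.) -/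

import Mathlib

namespace Pushing

open DyckStep

/-- Heights (values of `y - x`) of the starting points of the north steps `U` of a lattice path
that starts at height `h`; `D` is an east step. -/
def heightsFrom : ℕ → List DyckStep → List ℕ
  | _, [] => []
  | h, U :: l => h :: heightsFrom (h + 1) l
  | h, D :: l => heightsFrom (h - 1) l

/-- The area word of a Dyck path: the `i`-th vertical step starts on the diagonal `y = x + aᵢ`.
(Dyck paths never go below height `0`, so the subtraction in `heightsFrom` is not truncated.) -/
def areaWord (π : DyckWord) : List ℕ := heightsFrom 0 π.toList

/-- The `i`-th entry of the area word; positions are counted from `0`. -/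
def areaAt (π : DyckWord) (i : ℕ) : ℕ := (areaWord π).getD i 0

/-- The label of the `i`-th vertical step; positions are counted from `0`. -/
def labelAt (w : List ℕ) (i : ℕ) : ℕ := w.getD i 0

/-- `w` is a partial labelling of the Dyck path `π`: one label in `ℕ` for each vertical step,
strictly increasing up each column, the first label being positive. -/
structure IsPartialLabelling (π : DyckWord) (w : List ℕ) : Prop where
  length_eq : w.length = π.semilength
  column_lt : ∀ i, i + 1 < π.semilength → areaAt π i < areaAt π (i + 1) →
    labelAt w i < labelAt w (i + 1)
  first_pos : 0 < π.semilength → 0 < labelAt w 0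

/-- The contractible valleys of a labelled Dyck path. -/
def contractibleValleys (π : DyckWord) (w : List ℕ) : Finset ℕ :=
  (Finset.range π.semilength).filter fun i =>
    1 ≤ i ∧ (areaAt π i < areaAt π (i - 1) ∨
      (areaAt π i = areaAt π (i - 1) ∧ labelAt w (i - 1) < labelAt w i))

/-- Valley-decorated partially labelled Dyck paths `(π, w, dv)`. -/
@[ext]
structure DecoratedPath where
  path : DyckWord
  label : List ℕ
  dv : Finset ℕ
  isPartialLabelling : IsPartialLabelling path label
  dv_subset : dv ⊆ contractibleValleys path label

namespace DecoratedPath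

/-- The size of a path. -/
def size (P : DecoratedPath) : ℕ := P.path.semilength

/-- The number of labels equal to `0`. -/
def numZero (P : DecoratedPath) : ℕ := P.label.countP (fun x => x = 0)

/-- The number of positive labels. -/
def numPos (P : DecoratedPath) : ℕ := P.label.countP (fun x => 0 < x)

/-- The area. -/
def area (P : DecoratedPath) : ℕ := (areaWord P.path).sum

/-- The pair `(i, j)` is a diagonal inversion, primary or secondary. -/
def IsDiagInv (P : DecoratedPath) (i j : ℕ) : Prop :=
  (areaAt P.path i = areaAt P.path j ∧ labelAt P.label i < labelAt P.label j) ∨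
  (areaAt P.path i = areaAt P.path j + 1 ∧ labelAt P.label j < labelAt P.label i)

instance (P : DecoratedPath) (i j : ℕ) : Decidable (P.IsDiagInv i j) := by
  unfold IsDiagInv; infer_instance

/-- The dinv: the number of diagonal inversions `(i, j)`, `i < j`, with `i` not decorated, minus
the number of decorated valleys. -/
def dinv (P : DecoratedPath) : ℤ :=
  (((Finset.range P.size ×ˢ Finset.range P.size).filter
    fun e => e.1 < e.2 ∧ P.IsDiagInv e.1 e.2 ∧ e.1 ∉ P.dv).card : ℤ) - (P.dv.card : ℤ)

/-- The touch: the number of non-decorated, positively labelled vertical steps that start on the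
main diagonal. -/
def touch (P : DecoratedPath) : ℕ :=
  ((Finset.range P.size).filter
    fun i => areaAt P.path i = 0 ∧ 0 < labelAt P.label i ∧ i ∉ P.dv).card

/-- The exponent vector of the monomial `x^P`, the product of `x_{w_i}` at `x_0 = 1`. -/
noncomputable def xExp (P : DecoratedPath) : ℕ →₀ ℕ :=
  Multiset.toFinsupp (P.label.filter (fun x => 0 < x) : Multiset ℕ)

/-- `P` has exactly `m` labels equal to the maximal label `M`. (If `m` is positive then `M` is the
maximum of the labels of `P`; if `m = 0` then all labels are smaller than `M`.) -/
def HasMaxLabels (P : DecoratedPath) (M m : ℕ) : Prop :=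
  (∀ x ∈ P.label, x ≤ M) ∧ P.label.count M = m

end DecoratedPath

/-- The set `LD(m, n)^{• k}`: `m` labels `0`, `n` positive labels (hence size `m + n`) and `k`
decorated contractible valleys. It is empty if one of the integers `m, n, k` is negative. -/
def LD (m n k : ℤ) : Set DecoratedPath :=
  {P | (P.numZero : ℤ) = m ∧ (P.numPos : ℤ) = n ∧ (P.dv.card : ℤ) = k}

/-- The field `ℚ(q, t)`. -/
abbrev QT : Type := FractionRing (MvPolynomial (Fin 2) ℚ)

/-- The variable `q`. -/
noncomputable def q : QT := algebraMap (MvPolynomial (Fin 2) ℚ) QT (MvPolynomial.X 0)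

/-- The variable `t`. -/
noncomputable def t : QT := algebraMap (MvPolynomial (Fin 2) ℚ) QT (MvPolynomial.X 1)

/-- `[n]_q = 1 + q + ⋯ + q^(n-1)`. -/
noncomputable def qInt (n : ℕ) : QT := ∑ i ∈ Finset.range n, q ^ i

/-- `[n]_q! = [1]_q [2]_q ⋯ [n]_q`. -/
noncomputable def qFact (n : ℕ) : QT := ∏ i ∈ Finset.Icc 1 n, qInt i

/-- The `q`-binomial `[a choose b]_q`, equal to `0` unless `0 ≤ b ≤ a`. -/
noncomputable def qBinom (a b : ℤ) : QT :=
  if 0 ≤ b ∧ b ≤ a then qFact a.toNat / (qFact b.toNat * qFact (a - b).toNat) else 0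

/-- The formal power series in `x_1, x_2, …` that sums `q^dinv t^area x^P` over the paths `P` in
`LD(m, n)^{• k}` with touch `r`, given by its coefficients. -/
noncomputable def ldSeries (m n k r : ℤ) : MvPowerSeries ℕ QT := fun d =>
  ∑ᶠ P ∈ {P : DecoratedPath | P ∈ LD m n k ∧ (P.touch : ℤ) = r ∧ P.xExp = d},
    q ^ P.dinv * t ^ P.area

/-- The sum of `q^dinv t^area x^P`, with the variable `x_M` set to `1`, over the paths `P` in
`LD(n)^{• k}` with touch `r` that have exactly `m` labels equal to the maximal label `M`. -/
noncomputable def maxSeries (m n k r M : ℕ) : MvPowerSeries ℕ QT := fun d =>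
  ∑ᶠ P ∈ {P : DecoratedPath | P ∈ LD 0 n k ∧ P.touch = r ∧ P.HasMaxLabels M m ∧
      P.xExp.erase M = d},
    q ^ P.dinv * t ^ P.area

/-- There are finitely many paths of given size with bounded labels. -/
theorem finite_of_bounded (N B : ℕ) :
    {P : DecoratedPath | P.label.length = N ∧ ∀ x ∈ P.label, x ≤ B}.Finite := by
  classical
  have h1 : {l : List DyckStep | l.length = 2 * N}.Finite := by
    have : Finite DyckStep :=
      Finite.of_injective (fun s : DyckStep => decide (s = U)) (by
        intro a b; cases a <;> cases b <;> simp)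
    exact List.finite_length_eq _ _
  have h2 : {l : List ℕ | l.length = N ∧ ∀ x ∈ l, x ≤ B}.Finite := by
    refine ((List.finite_length_eq (Fin (B + 1)) N).image (List.map Fin.val)).subset ?_
    rintro l ⟨hl, hB⟩
    refine ⟨l.map (fun x => Fin.ofNat (B + 1) x), by simpa using hl, ?_⟩
    rw [List.map_map]
    conv_rhs => rw [← List.map_id l]
    refine List.map_congr_left fun x hx => ?_
    have := hB x hx
    simp [Fin.ofNat, Nat.mod_eq_of_lt (Nat.lt_succ_of_le this)]
  have h3 : {s : Finset ℕ | s ⊆ Finset.range N}.Finite :=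
    (Finset.finite_toSet (Finset.range N).powerset).subset fun s hs =>
      Finset.mem_coe.2 (Finset.mem_powerset.2 hs)
  refine Set.Finite.of_finite_image ((h1.prod (h2.prod h3)).subset ?_)
    (f := fun P : DecoratedPath => (P.path.toList, P.label, P.dv)) ?_
  · rintro _ ⟨P, ⟨hN, hB⟩, rfl⟩
    have hs : P.path.semilength = N := P.isPartialLabelling.length_eq.symm.trans hN
    refine ⟨?_, ⟨hN, hB⟩, ?_⟩
    · change P.path.toList.length = 2 * N
      rw [← DyckWord.two_mul_semilength_eq_length, hs]
    · intro i hi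
      have := P.dv_subset hi
      rw [contractibleValleys, Finset.mem_filter, hs] at this
      exact this.1
  · rintro P - Q - h
    simp only [Prod.mk.injEq] at h
    exact DecoratedPath.ext (DyckWord.ext h.1) h.2.1 h.2.2

theorem numZero_add_numPos (P : DecoratedPath) : P.numZero + P.numPos = P.label.length := by
  unfold DecoratedPath.numZero DecoratedPath.numPos
  induction P.label with
  | nil => rfl
  | cons a l ih =>
    rcases Nat.eq_zero_or_pos a with h | h
    · subst h; simp at ih ⊢; omega
    · have : a ≠ 0 := by omega
      simp [h, this] at ih ⊢; omega

/-- The sums that define the coefficients of `ldSeries` are finite. -/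
theorem ldSeries_finite (m n k r : ℤ) (d : ℕ →₀ ℕ) :
    {P : DecoratedPath | P ∈ LD m n k ∧ (P.touch : ℤ) = r ∧ P.xExp = d}.Finite := by
  refine (finite_of_bounded (m + n).toNat (d.support.sup id)).subset ?_
  rintro P ⟨⟨h1, h2, -⟩, -, rfl⟩
  refine ⟨by have := numZero_add_numPos P; omega, fun x hx => ?_⟩
  rcases Nat.eq_zero_or_pos x with h | h
  · omega
  · exact Finset.le_sup (f := id) (by simp [DecoratedPath.xExp, hx]; omega)

/-- The sums that define the coefficients of `maxSeries` are finite. -/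
theorem maxSeries_finite (m n k r M : ℕ) (d : ℕ →₀ ℕ) :
    {P : DecoratedPath | P ∈ LD 0 n k ∧ P.touch = r ∧ P.HasMaxLabels M m ∧
      P.xExp.erase M = d}.Finite := by
  refine (finite_of_bounded n M).subset ?_
  rintro P ⟨⟨h1, h2, -⟩, -, ⟨h3, -⟩, -⟩
  exact ⟨by have := numZero_add_numPos P; omega, h3⟩

end Pushing

namespace Pushing

open DyckStep

/-! Delete every label `M` on the main diagonal (a "bottom") and turn every other `M` into a `0` one
diagonal lower. If there are `p` bottoms, `i` of them decorated, the result has `m - p` zeros, `n -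
m` positive labels, `k - i` decorations and touch `s = r - p + i`, and the area drops by `m - p`.

Pushing keeps `κ = M * height - label` fixed. When the labels lie in a window of `M` consecutive
values (`1, …, M` before, `0, …, M - 1` after), `y` may follow `x` iff `κ y < κ x + M` (and `κ y < κ
x` if `y` is decorated), and `(x, y)` is an inversion iff `0 < κ x - κ y < M`. So pushing preserves
both relations among the surviving steps: `follows_push_iff`, `isInv_push_iff`.

It remains to reinsert the bottoms. A block of consecutive bottoms must be followed by a touch or
end the path; only its first member can be decorated, and not even that one at the start of the
path. So the blocks fill the `s + 1` gaps before the touches and at the end. In the gap after `c`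
touches an undecorated bottom weighs `q ^ c`, a decorated one `q ^ (c - 1)`, with at most one of the
latter, for `c ≥ 1`. The total is `h_{p-i}(1, …, q ^ s) * e_i(1, …, q ^ (s - 1))`, which is the
product of `q`-binomials in the theorem (`fibreSum_eq`, with `listDinv_eq` for the dinv). Paths are
handled as lists of steps. -/

/-! ### Gaussian binomials as symmetric polynomials in powers of `q`. -/

/-- The Gaussian binomial coefficients, defined by a Pascal recursion. -/
noncomputable def gaussBinom : ℕ → ℕ → QT
  | _, 0 => 1
  | 0, _ + 1 => 0
  | n + 1, k + 1 => q ^ (k + 1) * gaussBinom n (k + 1) + gaussBinom n k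

theorem gaussBinom_zero_right (n : ℕ) : gaussBinom n 0 = 1 := by
  cases n <;> rfl

theorem gaussBinom_succ_succ (n k : ℕ) :
    gaussBinom (n + 1) (k + 1) = q ^ (k + 1) * gaussBinom n (k + 1) + gaussBinom n k := rfl

theorem gaussBinom_eq_zero_of_lt {n k : ℕ} (h : n < k) : gaussBinom n k = 0 := by
  induction n generalizing k with
  | zero => obtain ⟨k, rfl⟩ : ∃ j, k = j + 1 := ⟨k - 1, by omega⟩; rfl
  | succ n ih =>
    obtain ⟨k, rfl⟩ : ∃ j, k = j + 1 := ⟨k - 1, by omega⟩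
    rw [gaussBinom_succ_succ, ih (by omega), ih (by omega)]; simp

theorem gaussBinom_self (n : ℕ) : gaussBinom n n = 1 := by
  induction n with
  | zero => rfl
  | succ n ih => rw [gaussBinom_succ_succ, ih, gaussBinom_eq_zero_of_lt (by omega)]; simp

theorem q_ne_zero : q ≠ 0 := by
  unfold q
  rw [Ne, FaithfulSMul.algebraMap_eq_zero_iff]
  exact MvPolynomial.X_ne_zero 0

theorem qInt_ne_zero (n : ℕ) : qInt (n + 1) ≠ 0 := by
  have : qInt (n + 1) = algebraMap (MvPolynomial (Fin 2) ℚ) QT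
      (∑ i ∈ Finset.range (n + 1), MvPolynomial.X 0 ^ i) := by
    simp [qInt, q]
  rw [this, Ne, FaithfulSMul.algebraMap_eq_zero_iff]
  intro h
  -- At `q = 1` the sum becomes `n + 1`, which is nonzero in `ℚ`.
  have h2 := congrArg (MvPolynomial.eval (fun _ => (1 : ℚ))) h
  simp at h2
  norm_cast at h2

theorem qInt_add (a b : ℕ) : qInt (a + b) = q ^ a * qInt b + qInt a := by
  simp [qInt, Finset.sum_range_add, Finset.mul_sum, pow_add, add_comm]

theorem qFact_zero : qFact 0 = 1 := by simp [qFact]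

theorem qFact_succ (n : ℕ) : qFact (n + 1) = qFact n * qInt (n + 1) := by
  rw [qFact, Finset.prod_Icc_succ_top (by omega)]; rfl

theorem qFact_ne_zero (n : ℕ) : qFact n ≠ 0 := by
  induction n with
  | zero => simp [qFact_zero]
  | succ n ih => rw [qFact_succ]; exact mul_ne_zero ih (qInt_ne_zero n)

/-- Pascal's recursion matches the splitting `[a + b] = q ^ a [b] + [a]`. -/
theorem gaussBinom_mul_qFact (a b : ℕ) :
    gaussBinom (a + b) a * (qFact a * qFact b) = qFact (a + b) := by
  induction a generalizing b with
  | zero => simp [gaussBinom_zero_right, qFact_zero]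
  | succ a iha =>
    induction b with
    | zero => simp [gaussBinom_self, qFact_zero]
    | succ b ihb =>
      have h1 := iha (b + 1)
      have e : a + 1 + (b + 1) = (a + 1 + b) + 1 := by ring
      have e1 : a + (b + 1) = a + 1 + b := by ring
      rw [e1] at h1
      rw [e, gaussBinom_succ_succ, qFact_succ (a + 1 + b), ← e, qInt_add (a + 1) (b + 1)]
      rw [qFact_succ b] at h1 ⊢
      rw [qFact_succ a] at ihb ⊢
      linear_combination (q ^ (a + 1) * qInt (b + 1)) * ihb + qInt (a + 1) * h1

theorem qBinom_natCast (n k : ℕ) : qBinom n k = gaussBinom n k := by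
  unfold qBinom
  split_ifs with h
  · obtain ⟨b, rfl⟩ : ∃ b, n = k + b := ⟨n - k, by omega⟩
    have e : ((k + b : ℕ) - (k : ℤ) : ℤ).toNat = b := by omega
    rw [e, Int.toNat_natCast, Int.toNat_natCast, ← gaussBinom_mul_qFact]
    exact mul_div_cancel_right₀ _ (mul_ne_zero (qFact_ne_zero _) (qFact_ne_zero _))
  · rw [gaussBinom_eq_zero_of_lt (by omega)]

/-- The complete homogeneous symmetric polynomial of degree `u` at `q ^ c, …, q ^ (c + s)`. -/
noncomputable def qComplete (c s u : ℕ) : QT := q ^ (c * u) * gaussBinom (s + u) u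

/-- The elementary symmetric polynomial of degree `i` at `q ^ c, …, q ^ (c + s - 1)`. -/
noncomputable def qElem (c s i : ℕ) : QT := q ^ (c * i + i.choose 2) * gaussBinom s i

theorem qComplete_zero (c s : ℕ) : qComplete c s 0 = 1 := by
  simp [qComplete, gaussBinom_zero_right]

theorem qElem_zero (c s : ℕ) : qElem c s 0 = 1 := by
  simp [qElem, gaussBinom_zero_right]

theorem qElem_zero_succ (c i : ℕ) : qElem c 0 (i + 1) = 0 := by
  simp [qElem, gaussBinom]

theorem qComplete_zero_succ (c u : ℕ) : qComplete c 0 (u + 1) = q ^ c * qComplete c 0 u := by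
  simp only [qComplete, zero_add, gaussBinom_self]; ring

/-- Monomials are sorted by whether the variable `q ^ c` occurs; likewise for `qElem`. -/
theorem qComplete_succ_succ (c s u : ℕ) :
    qComplete c (s + 1) (u + 1) = q ^ c * qComplete c (s + 1) u + qComplete (c + 1) s (u + 1) := by
  have e : s + 1 + (u + 1) = (s + 1 + u) + 1 := by ring
  have e' : s + (u + 1) = s + 1 + u := by ring
  simp only [qComplete, e, e', gaussBinom_succ_succ]; ring

theorem qElem_succ_succ (c s i : ℕ) :
    qElem c (s + 1) (i + 1) = qElem (c + 1) s (i + 1) + q ^ c * qElem (c + 1) s i := by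
  simp only [qElem, gaussBinom_succ_succ, Nat.choose_succ_succ i 1, Nat.choose_one_right]; ring

/-! ### Single steps and the pushing map. -/

/-- A vertical step of a decorated path: the diagonal on which it starts, its label, and whether it
is decorated. -/
@[ext]
structure Step where
  height : ℕ
  label : ℕ
  dec : Bool
deriving DecidableEq

namespace Step

/-- The step `y` may come directly after the step `x`. -/
def Follows (x y : Step) : Prop :=
  y.height ≤ x.height + 1 ∧ (x.height < y.height → x.label < y.label) ∧
    (y.dec = true → y.height < x.height ∨ (y.height = x.height ∧ x.label < y.label))

/-- A step that is counted by `touch`. -/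
def IsTouch (x : Step) : Prop := x.height = 0 ∧ 0 < x.label ∧ x.dec = false

instance : DecidablePred IsTouch := fun x => by unfold IsTouch; infer_instance

/-- The pair `(x, y)`, with `x` before `y`, contributes to the dinv. -/
def IsInv (x y : Step) : Prop :=
  ((x.height = y.height ∧ x.label < y.label) ∨ (x.height = y.height + 1 ∧ y.label < x.label)) ∧
    x.dec = false

instance : DecidableRel IsInv := fun x y => by unfold IsInv; infer_instance

/-- A step with label `M` on the main diagonal. -/
def IsBottom (M : ℕ) (x : Step) : Prop := x.label = M ∧ x.height = 0

instance (M : ℕ) : DecidablePred (IsBottom M) := fun x => by unfold IsBottom; infer_instance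

/-- Pushing the label `M` one diagonal down, where it becomes `0`. -/
def push (M : ℕ) (x : Step) : Step :=
  if x.label = M then ⟨x.height - 1, 0, x.dec⟩ else x

/-- Inverse of `push`. -/
def pull (M : ℕ) (x : Step) : Step :=
  if x.label = 0 then ⟨x.height + 1, M, x.dec⟩ else x

/-- The step may stand after `o`, where `none` is the start of the path. -/
def FollowsOption : Option Step → Step → Prop
  | none, x => x.IsTouch
  | some x, y => x.Follows y

variable {M : ℕ} {x y : Step}

/-- This is what allows a block of bottoms in front of a touch to be deleted. -/
theorem IsTouch.followsOption (h : y.IsTouch) (o : Option Step) : FollowsOption o y := by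
  cases o with
  | none => exact h
  | some x =>
    obtain ⟨h1, h2, h3⟩ := h
    exact ⟨by omega, by omega, by simp [h3]⟩

theorem pull_push (h0 : 0 < x.label) (hx : ¬ x.IsBottom M) : (x.push M).pull M = x := by
  by_cases h : x.label = M
  · have : x.height ≠ 0 := fun h' => hx ⟨h, h'⟩
    simp only [push, pull, h, if_true]
    ext <;> simp [h]; omega
  · simp [push, pull, h, h0.ne']

theorem push_pull (h : x.label < M) : (x.pull M).push M = x := by
  by_cases h0 : x.label = 0
  · simp only [pull, push, h0, if_true]
    ext <;> simp [h0]
  · simp [push, pull, h.ne, h0]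

theorem not_isBottom_pull (h : x.label < M) : ¬ (x.pull M).IsBottom M := by
  unfold pull IsBottom
  split_ifs <;> simp; omega

theorem pull_label_pos (hM : 0 < M) : 0 < (x.pull M).label := by
  unfold pull; grind

theorem pull_label_le (h : x.label < M) : (x.pull M).label ≤ M := by
  unfold pull; grind

theorem IsTouch.pull (h : x.IsTouch) : x.pull M = x := by
  simp [Step.pull, h.2.1.ne']

theorem isTouch_push_iff (hx : ¬ x.IsBottom M) : (x.push M).IsTouch ↔ x.IsTouch := by
  unfold push IsTouch
  split_ifs with h
  · have : x.height ≠ 0 := fun h' => hx ⟨h, h'⟩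
    simp [this]
  · rfl

theorem isTouch_push_iff_of_label_pos (h0 : 0 < x.label) (hx : ¬ x.IsBottom M) :
    (x.push M).IsTouch ↔ x.height = 0 ∧ x.dec = false := by
  rw [isTouch_push_iff hx]; simp [IsTouch, h0]

theorem push_dec : (x.push M).dec = x.dec := by
  unfold push; split_ifs <;> rfl

/-- The relation depends only on `M * height - label` and the decoration of `y`, and `push` changes
neither. -/
theorem follows_push_iff (hx0 : 0 < x.label) (hxM : x.label ≤ M) (hx : ¬ x.IsBottom M)
    (hy0 : 0 < y.label) (hyM : y.label ≤ M) (hy : ¬ y.IsBottom M) :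
    (x.push M).Follows (y.push M) ↔ x.Follows y := by
  unfold IsBottom at hx hy
  obtain ⟨a, w, b⟩ := x
  obtain ⟨a', w', b'⟩ := y
  simp only at *
  unfold push Follows
  cases b' <;> grind

/-- When exactly one of the two labels is `M`, primary and secondary inversions are exchanged;
otherwise the type is kept. -/
theorem isInv_push_iff (hx0 : 0 < x.label) (hxM : x.label ≤ M) (hx : ¬ x.IsBottom M)
    (hy0 : 0 < y.label) (hyM : y.label ≤ M) (hy : ¬ y.IsBottom M) :
    (x.push M).IsInv (y.push M) ↔ x.IsInv y := by
  unfold IsBottom at hx hy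
  unfold IsInv
  rw [push_dec]
  refine and_congr_left fun _ => ?_
  obtain ⟨a, w, b⟩ := x
  obtain ⟨a', w', b'⟩ := y
  simp only at *
  unfold push
  split_ifs <;> simp only at * <;> omega

/-- A secondary inversion would need a label above `M`, so only primary ones on the main diagonal
remain. -/
theorem isInv_bottom_iff (hx0 : 0 < x.label) (hxM : x.label ≤ M) (hx : ¬ x.IsBottom M)
    (hy : y.IsBottom M) : x.IsInv y ↔ x.IsTouch := by
  obtain ⟨h1, h2⟩ := hy
  unfold IsBottom at hx
  unfold IsInv IsTouch
  rw [h1, h2]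
  cases x.dec <;> simp
  omega

theorem not_isInv_of_isBottom (hx : x.IsBottom M) (hyM : y.label ≤ M) : ¬ x.IsInv y := by
  obtain ⟨h1, h2⟩ := hx
  unfold IsInv
  omega

theorem follows_of_isBottom_right (hxM : x.label ≤ M) (hx : ¬ x.IsBottom M) (hy : y.IsBottom M) :
    x.Follows y := by
  obtain ⟨h1, h2⟩ := hy
  unfold IsBottom at hx
  exact ⟨by omega, by omega, by omega⟩

/-- No label exceeds `M`, so the path can neither rise after a bottom nor have a contractible valley
there. -/
theorem follows_iff_of_isBottom_left (hx : x.IsBottom M) (hyM : y.label ≤ M) :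
    x.Follows y ↔ y.height = 0 ∧ y.dec = false := by
  obtain ⟨h1, h2⟩ := hx
  unfold Follows
  cases y.dec <;> simp <;> omega

end Step

open Step

/-! ### Lists of steps, their statistics, and their behaviour under pushing. -/

/-- The list of steps, read after `o`, is that of a decorated path. -/
def IsValid : Option Step → List Step → Prop
  | _, [] => True
  | o, x :: l => FollowsOption o x ∧ IsValid (some x) l

/-- The dinv of a list of steps. -/
def listDinv : List Step → ℤ
  | [] => 0
  | x :: l => (l.countP fun y => x.IsInv y) - (if x.dec then 1 else 0) + listDinv l

/-- The area of a list of steps. -/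
def listArea (l : List Step) : ℕ := (l.map Step.height).sum

/-- The touch of a list of steps. -/
def listTouch (l : List Step) : ℕ := l.countP fun x => x.IsTouch

/-- The number of decorations of a list of steps. -/
def listDec (l : List Step) : ℕ := l.countP fun x => x.dec

/-- The number of steps with label `0`. -/
def listZero (l : List Step) : ℕ := l.countP fun x => x.label = 0

/-- The number of steps with positive label. -/
def listPos (l : List Step) : ℕ := l.countP fun x => 0 < x.label

/-- The exponent vector of the monomial of a list of steps. -/
noncomputable def listExp (l : List Step) : ℕ →₀ ℕ :=
  Multiset.toFinsupp ((l.map Step.label).filter (fun x => 0 < x) : Multiset ℕ)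

/-- The number of undecorated steps with label `M` on the main diagonal. -/
def plainBottoms (M : ℕ) (l : List Step) : ℕ := l.countP fun x => x.IsBottom M ∧ x.dec = false

/-- The number of decorated steps with label `M` on the main diagonal. -/
def decBottoms (M : ℕ) (l : List Step) : ℕ := l.countP fun x => x.IsBottom M ∧ x.dec = true

/-- Delete the labels `M` on the main diagonal and push the other ones. -/
def pushList (M : ℕ) : List Step → List Step
  | [] => []
  | x :: l => if x.IsBottom M then pushList M l else x.push M :: pushList M l

/-- The labels are positive and at most `M`. -/
def LabelsIn (M : ℕ) (l : List Step) : Prop := ∀ x ∈ l, 0 < x.label ∧ x.label ≤ M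

/-- The steps with label `M` on the main diagonal are in admissible places. The flag says that
no such step may be decorated and that the next other step has to be a touch. -/
def BottomsOK (M : ℕ) : Bool → List Step → Prop
  | _, [] => True
  | b, x :: l =>
    if x.IsBottom M then (x.dec = true → b = false) ∧ BottomsOK M true l
    else (b = true → x.height = 0 ∧ x.dec = false) ∧ BottomsOK M false l

/-- The contribution to the dinv of the steps with label `M` on the main diagonal, when `c` touches
come before the list. -/
def bottomDinv (M : ℕ) : ℕ → List Step → ℤ
  | _, [] => 0
  | c, x :: l =>
    if x.IsBottom M then c - (if x.dec then 1 else 0) + bottomDinv M c l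
    else bottomDinv M (if x.IsTouch then c + 1 else c) l

variable {M : ℕ}

theorem labelsIn_cons {x : Step} {l : List Step} :
    LabelsIn M (x :: l) ↔ (0 < x.label ∧ x.label ≤ M) ∧ LabelsIn M l := by
  simp [LabelsIn]

/-- Both claims need each other in the induction. In the first, `o` is arbitrary because the next
surviving step has to be a touch, which may follow anything. -/
theorem isValid_after_iff (K : List Step) (hK : LabelsIn M K) :
    (∀ x : Step, x.IsBottom M → ∀ o, IsValid (some x) K ↔
      IsValid o (pushList M K) ∧ BottomsOK M true K) ∧
    (∀ x : Step, 0 < x.label → x.label ≤ M → ¬ x.IsBottom M → (IsValid (some x) K ↔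
      IsValid (some (x.push M)) (pushList M K) ∧ BottomsOK M false K)) := by
  induction K with
  | nil => simp [IsValid, pushList, BottomsOK]
  | cons y K ih =>
    obtain ⟨⟨hy0, hyM⟩, hK⟩ := labelsIn_cons.1 hK
    obtain ⟨ih1, ih2⟩ := ih hK
    constructor
    · intro x hx o
      by_cases hy : y.IsBottom M
      · simp only [IsValid, FollowsOption, pushList, BottomsOK, hy, if_true,
          follows_iff_of_isBottom_left hx hyM, ih1 y hy o, hy.2]
        cases y.dec <;> simp
      · simp only [IsValid, FollowsOption, pushList, BottomsOK, hy, if_false,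
          follows_iff_of_isBottom_left hx hyM, ih2 y hy0 hyM hy, true_imp_iff]
        constructor
        · rintro ⟨h1, h2, h3⟩
          exact ⟨⟨((isTouch_push_iff_of_label_pos hy0 hy).2 h1).followsOption o, h2⟩, h1, h3⟩
        · rintro ⟨⟨-, h2⟩, h1, h3⟩
          exact ⟨h1, h2, h3⟩
    · intro x hx0 hxM hx
      by_cases hy : y.IsBottom M
      · simp only [IsValid, FollowsOption, pushList, BottomsOK, hy, if_true,
          follows_of_isBottom_right hxM hx hy, ih1 y hy (some (x.push M))]
        simp
      · simp only [IsValid, FollowsOption, pushList, BottomsOK, hy, if_false,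
          follows_push_iff hx0 hxM hx hy0 hyM hy, ih2 y hy0 hyM hy]
        simp [and_assoc]

/-- The start of a path imposes the same conditions as a preceding bottom, hence the flag `true`. -/
theorem isValid_none_iff (K : List Step) (hK : LabelsIn M K) :
    IsValid none K ↔ IsValid none (pushList M K) ∧ BottomsOK M true K := by
  cases K with
  | nil => simp [IsValid, pushList, BottomsOK]
  | cons y K =>
    obtain ⟨⟨hy0, hyM⟩, hK⟩ := labelsIn_cons.1 hK
    obtain ⟨ih1, ih2⟩ := isValid_after_iff K hK
    by_cases hy : y.IsBottom M
    · simp only [IsValid, FollowsOption, pushList, BottomsOK, hy, if_true, ih1 y hy none, IsTouch,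
        hy.2, hy0]
      cases y.dec <;> simp
    · simp only [IsValid, FollowsOption, pushList, BottomsOK, hy, if_false,
        ih2 y hy0 hyM hy, isTouch_push_iff_of_label_pos hy0 hy, true_imp_iff]
      simp only [IsTouch, hy0, true_and]
      tauto

/-- Besides the preserved inversions, a touch has one with every later bottom. -/
theorem countP_isInv_pushList {x : Step} (hx0 : 0 < x.label) (hxM : x.label ≤ M)
    (hx : ¬ x.IsBottom M) (K : List Step) (hK : LabelsIn M K) :
    (K.countP fun y => x.IsInv y) = ((pushList M K).countP fun y => (x.push M).IsInv y) +
      if x.IsTouch then plainBottoms M K + decBottoms M K else 0 := by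
  induction K with
  | nil => simp [pushList, plainBottoms, decBottoms]
  | cons y K ih =>
    obtain ⟨⟨hy0, hyM⟩, hK⟩ := labelsIn_cons.1 hK
    have ih := ih hK
    by_cases hy : y.IsBottom M
    · simp only [pushList, hy, if_true, List.countP_cons, plainBottoms, decBottoms,
        isInv_bottom_iff hx0 hxM hx hy] at ih ⊢
      cases y.dec <;> by_cases ht : x.IsTouch <;> simp [ht] at ih ⊢ <;> omega
    · simp only [pushList, hy, if_false, List.countP_cons, plainBottoms, decBottoms,
        isInv_push_iff hx0 hxM hx hy0 hyM hy] at ih ⊢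
      simp only [ih]; simp; omega

/-- The parameter `c` serves the induction: raising it by one at a touch adds one per later bottom,
which is the correction in `countP_isInv_pushList`. The case of interest is `c = 0`. -/
theorem listDinv_eq (K : List Step) (hK : LabelsIn M K) (c : ℕ) :
    listDinv K = listDinv (pushList M K) + bottomDinv M c K -
      c * ((plainBottoms M K + decBottoms M K : ℕ) : ℤ) := by
  induction K generalizing c with
  | nil => simp [listDinv, pushList, bottomDinv, plainBottoms, decBottoms]
  | cons y K ih =>
    obtain ⟨⟨hy0, hyM⟩, hK⟩ := labelsIn_cons.1 hK
    have ih := ih hK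
    by_cases hy : y.IsBottom M
    · have h0 : (K.countP fun z => y.IsInv z) = 0 := by
        rw [List.countP_eq_zero]
        intro z hz
        simpa using not_isInv_of_isBottom hy (hK z hz).2
      have ih := ih c
      simp only [listDinv, h0, pushList, hy, if_true, bottomDinv, plainBottoms, decBottoms,
        List.countP_cons] at ih ⊢
      cases y.dec <;> simp at ih ⊢ <;> linarith
    · have ih := ih (if y.IsTouch then c + 1 else c)
      simp only [listDinv, countP_isInv_pushList hy0 hyM hy K hK, pushList, hy, if_false,
        bottomDinv, plainBottoms, decBottoms, List.countP_cons, push_dec] at ih ⊢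
      by_cases ht : y.IsTouch <;> simp [ht] at ih ⊢ <;> linarith

section Statistics

variable (K : List Step)

/-- The second conjunct keeps the natural subtraction in the first from truncating. -/
theorem listArea_pushList :
    listArea K = listArea (pushList M K) + (K.countP fun x => x.label = M) -
      (plainBottoms M K + decBottoms M K) ∧
    plainBottoms M K + decBottoms M K ≤ K.countP fun x => x.label = M := by
  induction K with
  | nil => simp [pushList, listArea, plainBottoms, decBottoms]
  | cons y K ih =>
    simp only [listArea, pushList, plainBottoms, decBottoms, List.countP_cons, List.map_cons,
      List.sum_cons] at ih ⊢
    by_cases hy : y.IsBottom M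
    · have h1 := hy.1
      have h2 := hy.2
      cases y.dec <;> simp [hy, h1, h2] at ih ⊢ <;> omega
    · by_cases h1 : y.label = M
      · have : y.height ≠ 0 := fun h => hy ⟨h1, h⟩
        simp [hy, h1, push] at ih ⊢; omega
      · simp [hy, h1, push] at ih ⊢; omega

theorem listTouch_pushList (hK : LabelsIn M K) :
    listTouch K = listTouch (pushList M K) + plainBottoms M K := by
  induction K with
  | nil => simp [pushList, listTouch, plainBottoms]
  | cons y K ih =>
    obtain ⟨⟨hy0, hyM⟩, hK⟩ := labelsIn_cons.1 hK
    have ih := ih hK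
    simp only [listTouch, pushList, plainBottoms, List.countP_cons] at ih ⊢
    by_cases hy : y.IsBottom M
    · have h2 := hy.2
      cases hd : y.dec <;> simp [hy, IsTouch, h2, hy0, hd] at ih ⊢ <;> omega
    · simp only [hy, if_false, List.countP_cons, isTouch_push_iff hy] at ih ⊢
      simp at ih ⊢; omega

theorem listDec_pushList : listDec K = listDec (pushList M K) + decBottoms M K := by
  induction K with
  | nil => simp [pushList, listDec, decBottoms]
  | cons y K ih =>
    simp only [listDec, pushList, decBottoms, List.countP_cons] at ih ⊢
    by_cases hy : y.IsBottom M
    · cases hd : y.dec <;> simp [hy] at ih ⊢ <;> omega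
    · simp only [hy, if_false, List.countP_cons, push_dec] at ih ⊢
      simp at ih ⊢; omega

theorem listZero_pushList (hK : LabelsIn M K) :
    (K.countP fun x => x.label = M) =
      listZero (pushList M K) + (plainBottoms M K + decBottoms M K) := by
  induction K with
  | nil => simp [pushList, listZero, plainBottoms, decBottoms]
  | cons y K ih =>
    obtain ⟨⟨hy0, hyM⟩, hK⟩ := labelsIn_cons.1 hK
    have ih := ih hK
    simp only [listZero, pushList, plainBottoms, decBottoms, List.countP_cons] at ih ⊢
    by_cases hy : y.IsBottom M
    · have h1 := hy.1
      cases y.dec <;> simp [hy, h1] at ih ⊢ <;> omega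
    · by_cases h1 : y.label = M
      · simp [hy, h1, push] at ih ⊢; omega
      · simp [hy, h1, push, hy0.ne'] at ih ⊢; omega

theorem listPos_pushList (hK : LabelsIn M K) :
    K.length = listPos (pushList M K) + K.countP fun x => x.label = M := by
  induction K with
  | nil => simp [pushList, listPos]
  | cons y K ih =>
    obtain ⟨⟨hy0, hyM⟩, hK⟩ := labelsIn_cons.1 hK
    have ih := ih hK
    simp only [listPos, pushList, List.countP_cons, List.length_cons] at ih ⊢
    by_cases hy : y.IsBottom M
    · have h1 := hy.1
      simp [hy, h1] at ih ⊢; omega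
    · by_cases h1 : y.label = M
      · simp [hy, h1, push] at ih ⊢; omega
      · simp [hy, h1, push, hy0] at ih ⊢; omega

theorem listExp_cons (x : Step) :
    listExp (x :: K) = (if 0 < x.label then Finsupp.single x.label 1 else 0) + listExp K := by
  unfold listExp
  split_ifs with h
  · simp only [List.map_cons, h, decide_true, List.filter_cons_of_pos]
    rw [← Multiset.cons_coe, ← Multiset.singleton_add, map_add, Multiset.toFinsupp_singleton]
  · simp [h]

theorem listExp_pushList (hK : LabelsIn M K) :
    listExp (pushList M K) = (listExp K).erase M := by
  induction K with
  | nil => simp [pushList, listExp]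
  | cons y K ih =>
    obtain ⟨⟨hy0, hyM⟩, hK⟩ := labelsIn_cons.1 hK
    have ih := ih hK
    rw [listExp_cons, if_pos hy0, Finsupp.erase_add, ← ih]
    by_cases hy : y.IsBottom M
    · have h1 := hy.1
      simp [pushList, hy, h1]
    · simp only [pushList, hy, if_false, listExp_cons]
      by_cases h1 : y.label = M
      · simp [push, h1]
      · simp [push, h1, hy0, Finsupp.erase_of_notMem_support, Ne.symm h1]

end Statistics

/-! ### Fibres of the pushing map and their generating functions. -/

/-- The lists with labels in `1, …, M` that `pushList` maps to `L`, that are admissible in the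
sense of `BottomsOK`, and that have `u` undecorated and `i` decorated labels `M` on the main
diagonal. -/
def InFibre (M : ℕ) (b : Bool) (L : List Step) (u i : ℕ) (K : List Step) : Prop :=
  LabelsIn M K ∧ pushList M K = L ∧ BottomsOK M b K ∧ plainBottoms M K = u ∧ decBottoms M K = i

/-- The fibre is finite, and `v` is the sum of `q ^ bottomDinv` over it. -/
def FibreSum (M c : ℕ) (b : Bool) (L : List Step) (u i : ℕ) (v : QT) : Prop :=
  ∃ S : Finset (List Step), (∀ K, K ∈ S ↔ InFibre M b L u i K) ∧
    ∑ K ∈ S, q ^ bottomDinv M c K = v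

theorem inFibre_nil_iff {b : Bool} {L : List Step} {u i : ℕ} :
    InFibre M b L u i [] ↔ L = [] ∧ u = 0 ∧ i = 0 := by
  simp only [InFibre, LabelsIn, pushList, BottomsOK, plainBottoms, decBottoms, List.countP_nil,
    List.not_mem_nil, false_imp_iff, implies_true, true_and, eq_comm (a := []),
    eq_comm (a := 0)]

theorem inFibre_plain_cons_iff (hM : 0 < M) {b : Bool} {L K : List Step} {u i : ℕ} :
    InFibre M b L u i (⟨0, M, false⟩ :: K) ↔ ∃ u', u = u' + 1 ∧ InFibre M true L u' i K := by
  have h : IsBottom M ⟨0, M, false⟩ := ⟨rfl, rfl⟩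
  simp only [InFibre, labelsIn_cons, pushList, BottomsOK, plainBottoms, decBottoms, h, if_true,
    List.countP_cons]
  simp only [hM, le_refl, Bool.false_eq_true, and_true, and_false, decide_true, decide_false,
    if_true, if_false, true_and, add_zero, false_imp_iff]
  constructor
  · rintro ⟨h1, h2, h3, h4, h5⟩
    exact ⟨_, h4.symm, h1, h2, h3, rfl, h5⟩
  · rintro ⟨u', rfl, h1, h2, h3, h4, h5⟩
    exact ⟨h1, h2, h3, by rw [h4], h5⟩

theorem inFibre_dec_cons_iff (hM : 0 < M) {b : Bool} {L K : List Step} {u i : ℕ} :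
    InFibre M b L u i (⟨0, M, true⟩ :: K) ↔
      b = false ∧ ∃ i', i = i' + 1 ∧ InFibre M true L u i' K := by
  have h : IsBottom M ⟨0, M, true⟩ := ⟨rfl, rfl⟩
  simp only [InFibre, labelsIn_cons, pushList, BottomsOK, plainBottoms, decBottoms, h, if_true,
    List.countP_cons]
  simp only [hM, le_refl, Bool.true_eq_false, and_true, and_false, decide_true, decide_false,
    if_true, if_false, true_and, add_zero, true_imp_iff, Bool.false_eq_true]
  constructor
  · rintro ⟨h1, h2, ⟨h3, h3'⟩, h4, h5⟩
    exact ⟨h3, _, h5.symm, h1, h2, h3', h4, rfl⟩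
  · rintro ⟨h3, u', rfl, h1, h2, h3', h4, h5⟩
    exact ⟨h1, h2, ⟨h3, h3'⟩, h4, by rw [h5]⟩

theorem inFibre_cons_iff_of_not_isBottom {x : Step} (hx : ¬ x.IsBottom M) {b : Bool}
    {L K : List Step} {u i : ℕ} :
    InFibre M b L u i (x :: K) ↔ (0 < x.label ∧ x.label ≤ M) ∧
      (b = true → x.height = 0 ∧ x.dec = false) ∧
      ∃ L', L = x.push M :: L' ∧ InFibre M false L' u i K := by
  simp only [InFibre, labelsIn_cons, pushList, BottomsOK, plainBottoms, decBottoms, hx, if_false,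
    List.countP_cons, false_and, decide_false, Bool.false_eq_true, add_zero]
  constructor
  · rintro ⟨⟨h0, h1⟩, h2, ⟨h3, h3'⟩, h4, h5⟩
    exact ⟨h0, h3, _, h2.symm, h1, rfl, h3', h4, h5⟩
  · rintro ⟨h0, h3, L', rfl, h1, rfl, h3', h4, h5⟩
    exact ⟨⟨h0, h1⟩, rfl, ⟨h3, h3'⟩, h4, h5⟩

theorem eq_of_isBottom {x : Step} (hx : x.IsBottom M) :
    x = ⟨0, M, false⟩ ∨ x = ⟨0, M, true⟩ := by
  obtain ⟨a, w, d⟩ := x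
  obtain ⟨h1, h2⟩ := hx
  simp only at h1 h2
  subst h1 h2
  cases d <;> simp

/-- Bottoms leave the flag `true`, so the first step of `K` that is not a bottom, the one pushed to
`y`, is subject to it. -/
theorem isTouch_of_inFibre_true {y : Step} {L K : List Step} {u i : ℕ}
    (h : InFibre M true (y :: L) u i K) : y.IsTouch := by
  induction K generalizing u i with
  | nil => simp [inFibre_nil_iff] at h
  | cons x K ih =>
    by_cases hx : x.IsBottom M
    · have hM : 0 < M := hx.1 ▸ (h.1 x (by simp)).1
      rcases eq_of_isBottom hx with rfl | rfl
      · obtain ⟨u', -, h⟩ := (inFibre_plain_cons_iff hM).1 h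
        exact ih h
      · simp [inFibre_dec_cons_iff hM] at h
    · obtain ⟨⟨h0, -⟩, h1, L', h2, -⟩ := (inFibre_cons_iff_of_not_isBottom hx).1 h
      rw [(List.cons.inj h2).1]
      exact (isTouch_push_iff_of_label_pos h0 hx).2 (h1 rfl)

/-- The members of a fibre over a nonempty list. -/
theorem inFibre_cons_iff (hM : 0 < M) {y : Step} (hy : y.label < M) {b : Bool}
    {L K : List Step} {u i : ℕ} :
    InFibre M b (y :: L) u i K ↔
      (∃ K' u', K = ⟨0, M, false⟩ :: K' ∧ u = u' + 1 ∧ InFibre M true (y :: L) u' i K') ∨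
      (b = false ∧ ∃ K' i', K = ⟨0, M, true⟩ :: K' ∧ i = i' + 1 ∧
        InFibre M true (y :: L) u i' K') ∨
      ((b = true → y.IsTouch) ∧ ∃ K', K = y.pull M :: K' ∧ InFibre M false L u i K') := by
  have hb := not_isBottom_pull hy
  constructor
  · intro h
    cases K with
    | nil => simp [inFibre_nil_iff] at h
    | cons x K =>
      by_cases hx : x.IsBottom M
      · rcases eq_of_isBottom hx with rfl | rfl
        · obtain ⟨u', hu, h⟩ := (inFibre_plain_cons_iff hM).1 h
          exact Or.inl ⟨K, u', rfl, hu, h⟩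
        · obtain ⟨hb, i', hi, h⟩ := (inFibre_dec_cons_iff hM).1 h
          exact Or.inr (Or.inl ⟨hb, K, i', rfl, hi, h⟩)
      · obtain ⟨⟨h0, -⟩, h1, L', h2, h3⟩ := (inFibre_cons_iff_of_not_isBottom hx).1 h
        obtain ⟨rfl, rfl⟩ := List.cons.inj h2
        refine Or.inr (Or.inr ⟨fun hb => ?_, K, by rw [pull_push h0 hx], h3⟩)
        exact (isTouch_push_iff_of_label_pos h0 hx).2 (h1 hb)
  · rintro (⟨K', u', rfl, hu, h⟩ | ⟨hb, K', i', rfl, hi, h⟩ | ⟨ht, K', rfl, h⟩)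
    · exact (inFibre_plain_cons_iff hM).2 ⟨u', hu, h⟩
    · exact (inFibre_dec_cons_iff hM).2 ⟨hb, i', hi, h⟩
    · refine (inFibre_cons_iff_of_not_isBottom hb).2
        ⟨⟨pull_label_pos hM, pull_label_le hy⟩, fun h' => ?_, L, by rw [push_pull hy], h⟩
      rw [(ht h').pull]
      exact ⟨(ht h').1, (ht h').2.2⟩

/-- The members of a fibre over the empty list. -/
theorem inFibre_nil_left_iff (hM : 0 < M) {b : Bool} {K : List Step} {u i : ℕ} :
    InFibre M b [] u i K ↔
      (∃ K' u', K = ⟨0, M, false⟩ :: K' ∧ u = u' + 1 ∧ InFibre M true [] u' i K') ∨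
      (b = false ∧ ∃ K' i', K = ⟨0, M, true⟩ :: K' ∧ i = i' + 1 ∧ InFibre M true [] u i' K') ∨
      (K = [] ∧ u = 0 ∧ i = 0) := by
  constructor
  · intro h
    cases K with
    | nil => simpa [inFibre_nil_iff] using h
    | cons x K =>
      by_cases hx : x.IsBottom M
      · rcases eq_of_isBottom hx with rfl | rfl
        · obtain ⟨u', hu, h⟩ := (inFibre_plain_cons_iff hM).1 h
          exact Or.inl ⟨K, u', rfl, hu, h⟩
        · obtain ⟨hb, i', hi, h⟩ := (inFibre_dec_cons_iff hM).1 h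
          exact Or.inr (Or.inl ⟨hb, K, i', rfl, hi, h⟩)
      · obtain ⟨-, -, L', h2, -⟩ := (inFibre_cons_iff_of_not_isBottom hx).1 h
        cases h2
  · rintro (⟨K', u', rfl, hu, h⟩ | ⟨hb, K', i', rfl, hi, h⟩ | ⟨rfl, h⟩)
    · exact (inFibre_plain_cons_iff hM).2 ⟨u', hu, h⟩
    · exact (inFibre_dec_cons_iff hM).2 ⟨hb, i', hi, h⟩
    · exact inFibre_nil_iff.2 ⟨rfl, h⟩

theorem sum_image_cons (x : Step) (S : Finset (List Step)) (f : List Step → QT) :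
    ∑ K ∈ S.image (List.cons x), f K = ∑ K ∈ S, f (x :: K) :=
  Finset.sum_image fun _ _ _ _ h => (List.cons.inj h).2

theorem sum_plain_cons (c : ℕ) (S : Finset (List Step)) :
    ∑ K ∈ S.image (List.cons ⟨0, M, false⟩), q ^ bottomDinv M c K =
      q ^ c * ∑ K ∈ S, q ^ bottomDinv M c K := by
  rw [sum_image_cons, Finset.mul_sum]
  refine Finset.sum_congr rfl fun K _ => ?_
  have h : IsBottom M ⟨0, M, false⟩ := ⟨rfl, rfl⟩
  simp [bottomDinv, h, zpow_add₀ q_ne_zero]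

/-- The decoration lowers the contribution `c + 1` to `c`. -/
theorem sum_dec_cons (c : ℕ) (S : Finset (List Step)) :
    ∑ K ∈ S.image (List.cons ⟨0, M, true⟩), q ^ bottomDinv M (c + 1) K =
      q ^ c * ∑ K ∈ S, q ^ bottomDinv M (c + 1) K := by
  rw [sum_image_cons, Finset.mul_sum]
  refine Finset.sum_congr rfl fun K _ => ?_
  have h : IsBottom M ⟨0, M, true⟩ := ⟨rfl, rfl⟩
  simp [bottomDinv, h, zpow_add₀ q_ne_zero]

theorem disjoint_image_cons {x y : Step} (h : x ≠ y) (S T : Finset (List Step)) :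
    Disjoint (S.image (List.cons x)) (T.image (List.cons y)) := by
  rw [Finset.disjoint_left]
  intro K h1 h2
  obtain ⟨K1, -, rfl⟩ := Finset.mem_image.1 h1
  obtain ⟨K2, -, h3⟩ := Finset.mem_image.1 h2
  exact h (List.cons.inj h3).1.symm

theorem fibreSum_nil (hM : 0 < M) (c u i : ℕ) :
    FibreSum M c true [] u i (qComplete c 0 u * qElem c 0 i) := by
  induction u with
  | zero =>
    cases i with
    | zero =>
      refine ⟨{[]}, fun K => ?_, by simp [bottomDinv, qComplete_zero, qElem_zero]⟩
      rw [inFibre_nil_left_iff hM]; simp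
    | succ i =>
      refine ⟨∅, fun K => ?_, by simp [qElem_zero_succ]⟩
      rw [inFibre_nil_left_iff hM]; simp
  | succ u ih =>
    obtain ⟨S, hS, hv⟩ := ih
    refine ⟨S.image (List.cons ⟨0, M, false⟩), fun K => ?_, ?_⟩
    · rw [inFibre_nil_left_iff hM]
      simp only [Finset.mem_image, hS]
      constructor
      · rintro ⟨K', h, rfl⟩
        exact Or.inl ⟨K', u, rfl, rfl, h⟩
      · rintro (⟨K', u', rfl, hu, h⟩ | ⟨hb, -⟩ | ⟨-, hu, -⟩)
        · obtain rfl : u = u' := by omega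
          exact ⟨K', h, rfl⟩
        · cases hb
        · omega
    · rw [sum_plain_cons, hv, qComplete_zero_succ, mul_assoc]

/-- Either the current gap receives one more plain bottom, of weight `q ^ c`, or it is closed by
`y`: the recursion of `qComplete`. The factor `e` belongs to the decorated bottoms of later gaps. -/
theorem fibreSum_touch_cons (hM : 0 < M) {y : Step} (hy : y.label < M) (ht : y.IsTouch)
    {L : List Step} {c s i : ℕ} {e : QT}
    (h : ∀ u, FibreSum M (c + 1) false L u i (qComplete (c + 1) s u * e)) (u : ℕ) :
    FibreSum M c true (y :: L) u i (qComplete c (s + 1) u * e) := by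
  have hb : ¬ y.IsBottom M := fun h => by have := h.1; omega
  have hsum : ∀ S : Finset (List Step), ∑ K ∈ S.image (List.cons y), q ^ bottomDinv M c K =
      ∑ K ∈ S, q ^ bottomDinv M (c + 1) K := fun S => by
    rw [sum_image_cons]; simp [bottomDinv, hb, ht]
  induction u with
  | zero =>
    obtain ⟨S, hS, hv⟩ := h 0
    refine ⟨S.image (List.cons y), fun K => ?_, ?_⟩
    · rw [inFibre_cons_iff hM hy, ht.pull]
      simp only [Finset.mem_image, hS]
      constructor
      · rintro ⟨K', h, rfl⟩
        exact Or.inr (Or.inr ⟨fun _ => ht, K', rfl, h⟩)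
      · rintro (⟨K', u', rfl, hu, h⟩ | ⟨hb, -⟩ | ⟨-, K', rfl, h⟩)
        · omega
        · cases hb
        · exact ⟨K', h, rfl⟩
    · rw [hsum, hv, qComplete_zero, qComplete_zero]
  | succ u ih =>
    obtain ⟨S, hS, hv⟩ := h (u + 1)
    obtain ⟨T, hT, hw⟩ := ih
    refine ⟨T.image (List.cons ⟨0, M, false⟩) ∪ S.image (List.cons y), fun K => ?_, ?_⟩
    · rw [inFibre_cons_iff hM hy, ht.pull]
      simp only [Finset.mem_union, Finset.mem_image, hS, hT]
      constructor
      · rintro (⟨K', h, rfl⟩ | ⟨K', h, rfl⟩)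
        · exact Or.inl ⟨K', u, rfl, rfl, h⟩
        · exact Or.inr (Or.inr ⟨fun _ => ht, K', rfl, h⟩)
      · rintro (⟨K', u', rfl, hu, h⟩ | ⟨hb, -⟩ | ⟨-, K', rfl, h⟩)
        · obtain rfl : u = u' := by omega
          exact Or.inl ⟨K', h, rfl⟩
        · cases hb
        · exact Or.inr ⟨K', h, rfl⟩
    · rw [Finset.sum_union (disjoint_image_cons (by rintro rfl; exact hb ⟨rfl, rfl⟩) _ _),
        sum_plain_cons, hsum, hv, hw, qComplete_succ_succ]
      ring

theorem inFibre_false_iff (hM : 0 < M) {L : List Step} (hL : ∀ y ∈ L, y.label < M)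
    (hh : ∀ y ∈ L.head?, y.IsTouch) {u i : ℕ} {K : List Step} :
    InFibre M false L u i K ↔ InFibre M true L u i K ∨
      ∃ K' i', K = ⟨0, M, true⟩ :: K' ∧ i = i' + 1 ∧ InFibre M true L u i' K' := by
  cases L with
  | nil =>
    rw [inFibre_nil_left_iff hM, inFibre_nil_left_iff hM (b := true)]
    simp only [true_and, Bool.true_eq_false, false_and, false_or]
    rw [or_assoc, or_comm (a := K = [] ∧ _)]
  | cons y L =>
    have hy : y.IsTouch := hh y (by simp)
    rw [inFibre_cons_iff hM (hL y (by simp)), inFibre_cons_iff hM (hL y (by simp)) (b := true)]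
    simp only [true_and, Bool.true_eq_false, false_and, false_or, hy, implies_true]
    rw [or_assoc, or_comm (b := ∃ K', K = y.pull M :: K' ∧ _)]

/-- A gap is being opened, and its first bottom may be decorated, with weight `q ^ c`, or not: the
recursion of `qElem`. Afterwards the flag is `true`. -/
theorem fibreSum_false (hM : 0 < M) {L : List Step} (hL : ∀ y ∈ L, y.label < M)
    (hh : ∀ y ∈ L.head?, y.IsTouch) {c s u : ℕ} {v : QT}
    (h : ∀ i, FibreSum M (c + 1) true L u i (v * qElem (c + 1) s i)) (i : ℕ) :
    FibreSum M (c + 1) false L u i (v * qElem c (s + 1) i) := by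
  cases i with
  | zero =>
    obtain ⟨S, hS, hv⟩ := h 0
    refine ⟨S, fun K => ?_, by rw [hv, qElem_zero, qElem_zero]⟩
    rw [inFibre_false_iff hM hL hh, hS]
    simp
  | succ i =>
    obtain ⟨S, hS, hv⟩ := h (i + 1)
    obtain ⟨T, hT, hw⟩ := h i
    refine ⟨S ∪ T.image (List.cons ⟨0, M, true⟩), fun K => ?_, ?_⟩
    · rw [inFibre_false_iff hM hL hh]
      simp only [Finset.mem_union, Finset.mem_image, hS, hT]
      refine or_congr_right ⟨?_, ?_⟩
      · rintro ⟨K', h, rfl⟩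
        exact ⟨K', i, rfl, rfl, h⟩
      · rintro ⟨K', i', rfl, hi, h⟩
        obtain rfl : i = i' := by omega
        exact ⟨K', h, rfl⟩
    · rw [Finset.sum_union, sum_dec_cons, hv, hw, qElem_succ_succ]
      · ring
      · rw [Finset.disjoint_left]
        intro K h1 h2
        obtain ⟨K', -, rfl⟩ := Finset.mem_image.1 h2
        have := ((inFibre_dec_cons_iff hM).1 ((hS _).1 h1)).1
        cases this

/-- No bottom can stand directly before a step that does not push to a touch. -/
theorem fibreSum_not_touch_cons (hM : 0 < M) {y : Step} (hy : y.label < M) (ht : ¬ y.IsTouch)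
    {L : List Step} {c u i : ℕ} {v : QT} (h : FibreSum M c false L u i v) :
    FibreSum M c false (y :: L) u i v := by
  obtain ⟨S, hS, hv⟩ := h
  refine ⟨S.image (List.cons (y.pull M)), fun K => ?_, ?_⟩
  · rw [inFibre_cons_iff hM hy]
    simp only [Finset.mem_image, hS]
    constructor
    · rintro ⟨K', h, rfl⟩
      exact Or.inr (Or.inr ⟨nofun, K', rfl, h⟩)
    · rintro (⟨K', u', rfl, hu, h⟩ | ⟨hb, K', i', rfl, hu, h⟩ | ⟨-, K', rfl, h⟩)
      · exact absurd (isTouch_of_inFibre_true h) ht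
      · exact absurd (isTouch_of_inFibre_true h) ht
      · exact ⟨K', h, rfl⟩
  · have hb := not_isBottom_pull hy
    have ht' : ¬ (y.pull M).IsTouch := by rwa [← isTouch_push_iff hb, push_pull hy]
    rw [sum_image_cons, ← hv]
    simp [bottomDinv, hb, ht']

/-- With `s` touches in `L`, the gaps still open are `c + 1, …, c + 1 + s`. Each of them may hold a
decorated bottom, so `qElem` has `s + 1` variables, starting at `q ^ c`. -/
theorem fibreSum_false_eq (hM : 0 < M) (L : List Step) (hL : ∀ y ∈ L, y.label < M) (c u i : ℕ) :
    FibreSum M (c + 1) false L u i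
      (qComplete (c + 1) (listTouch L) u * qElem c (listTouch L + 1) i) := by
  induction L generalizing c u i with
  | nil => exact fibreSum_false hM hL (by simp) (fun i => fibreSum_nil hM _ _ i) i
  | cons y L ih =>
    have hy := hL y (by simp)
    have ih := ih fun z hz => hL z (by simp [hz])
    by_cases ht : y.IsTouch
    · have e : listTouch (y :: L) = listTouch L + 1 := by simp [listTouch, ht]
      rw [e]
      exact fibreSum_false hM hL (by simpa using ht)
        (fun i => fibreSum_touch_cons hM hy ht (fun u => ih (c + 1) u i) u) i
    · have e : listTouch (y :: L) = listTouch L := by simp [listTouch, ht]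
      rw [e]
      exact fibreSum_not_touch_cons hM hy ht (ih c u i)

/-- The gap at the start admits no decorated bottom, so `qElem` has one variable fewer than
`qComplete`. Validity of `L` makes its head a touch. -/
theorem fibreSum_eq (hM : 0 < M) (L : List Step) (hL : ∀ y ∈ L, y.label < M)
    (hv : IsValid none L) (u i : ℕ) :
    FibreSum M 0 true L u i (gaussBinom (listTouch L + u) u *
      (q ^ i.choose 2 * gaussBinom (listTouch L) i)) := by
  have key : FibreSum M 0 true L u i
      (qComplete 0 (listTouch L) u * qElem 0 (listTouch L) i) := by
    cases L with
    | nil => exact fibreSum_nil hM 0 u i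
    | cons y L =>
      have ht : y.IsTouch := hv.1
      have e : listTouch (y :: L) = listTouch L + 1 := by simp [listTouch, ht]
      rw [e]
      exact fibreSum_touch_cons hM (hL y (by simp)) ht
        (fun u => fibreSum_false_eq hM L (fun z hz => hL z (by simp [hz])) 0 u i) u
  simpa [qComplete, qElem] using key

/-! ### Dyck paths and their area words. -/

/-- The path with the given heights of its north steps, from height `h` down to height `0`. -/
def pathOf : ℕ → List ℕ → List DyckStep
  | h, [] => List.replicate h D
  | h, a :: l => List.replicate (h - a) D ++ U :: pathOf (a + 1) l

/-- The path from height `h` never goes below height `0`, where it ends. -/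
def IsDyckFrom : ℕ → List DyckStep → Prop
  | h, [] => h = 0
  | h, U :: l => IsDyckFrom (h + 1) l
  | h, D :: l => 0 < h ∧ IsDyckFrom (h - 1) l

/-- Each entry exceeds the previous one, which is `h - 1` at the start, by at most `1`. -/
def IsAreaFrom : ℕ → List ℕ → Prop
  | _, [] => True
  | h, a :: l => a ≤ h ∧ IsAreaFrom (a + 1) l

theorem isDyckFrom_iff (h : ℕ) (l : List DyckStep) :
    IsDyckFrom h l ↔ h + l.count U = l.count D ∧
      ∀ i, (l.take i).count D ≤ h + (l.take i).count U := by
  induction l generalizing h with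
  | nil => simp [IsDyckFrom]
  | cons s l ih =>
    cases s with
    | U =>
      simp only [IsDyckFrom, ih, List.count_cons]
      constructor
      · rintro ⟨h1, h2⟩
        refine ⟨by simp; omega, fun i => ?_⟩
        cases i with
        | zero => simp
        | succ i => have := h2 i; simp; omega
      · rintro ⟨h1, h2⟩
        refine ⟨by simp at h1; omega, fun i => ?_⟩
        have := h2 (i + 1)
        simp at this; omega
    | D =>
      simp only [IsDyckFrom, ih, List.count_cons]
      constructor
      · rintro ⟨h0, h1, h2⟩
        refine ⟨by simp; omega, fun i => ?_⟩
        cases i with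
        | zero => simp
        | succ i => have := h2 i; simp; omega
      · rintro ⟨h1, h2⟩
        have h0 : 0 < h := by have := h2 1; simp at this; omega
        refine ⟨h0, by simp at h1; omega, fun i => ?_⟩
        have := h2 (i + 1)
        simp at this; omega

theorem isDyckFrom_dyckWord (π : DyckWord) : IsDyckFrom 0 π.toList := by
  rw [isDyckFrom_iff]
  exact ⟨by simpa using π.count_U_eq_count_D, by simpa using π.count_D_le_count_U⟩

theorem isDyckFrom_replicate_append (h j : ℕ) (hj : j ≤ h) (l : List DyckStep) :
    IsDyckFrom h (List.replicate j D ++ l) ↔ IsDyckFrom (h - j) l := by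
  induction j generalizing h with
  | zero => simp
  | succ j ih =>
    simp only [List.replicate_succ, List.cons_append, IsDyckFrom]
    rw [ih _ (by omega), show h - 1 - j = h - (j + 1) by omega]
    simp; omega

theorem isDyckFrom_pathOf (h : ℕ) (l : List ℕ) (hl : IsAreaFrom h l) :
    IsDyckFrom h (pathOf h l) := by
  induction l generalizing h with
  | nil =>
    rw [pathOf, ← List.append_nil (List.replicate h D), isDyckFrom_replicate_append h h le_rfl]
    simp [IsDyckFrom]
  | cons a l ih =>
    obtain ⟨h1, h2⟩ := hl
    rw [pathOf, isDyckFrom_replicate_append h _ (by omega), show h - (h - a) = a by omega]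
    exact ih _ h2

theorem heightsFrom_replicate_append (h j : ℕ) (l : List DyckStep) :
    heightsFrom h (List.replicate j D ++ l) = heightsFrom (h - j) l := by
  induction j generalizing h with
  | zero => simp
  | succ j ih =>
    simp only [List.replicate_succ, List.cons_append, heightsFrom]
    rw [ih, show h - 1 - j = h - (j + 1) by omega]

theorem heightsFrom_pathOf (h : ℕ) (l : List ℕ) (hl : IsAreaFrom h l) :
    heightsFrom h (pathOf h l) = l := by
  induction l generalizing h with
  | nil =>
    rw [pathOf, ← List.append_nil (List.replicate h D), heightsFrom_replicate_append]; rfl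
  | cons a l ih =>
    obtain ⟨h1, h2⟩ := hl
    rw [pathOf, heightsFrom_replicate_append, show h - (h - a) = a by omega, heightsFrom, ih _ h2]

theorem isAreaFrom_mono {h h' : ℕ} (hh : h ≤ h') (l : List ℕ) (hl : IsAreaFrom h l) :
    IsAreaFrom h' l := by
  cases l with
  | nil => trivial
  | cons a l => exact ⟨hl.1.trans hh, hl.2⟩

theorem isAreaFrom_heightsFrom (h : ℕ) (l : List DyckStep) : IsAreaFrom h (heightsFrom h l) := by
  induction l generalizing h with
  | nil => trivial
  | cons s l ih =>
    cases s with
    | U => exact ⟨le_rfl, ih _⟩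
    | D => exact isAreaFrom_mono (Nat.sub_le h 1) _ (ih _)

theorem pathOf_eq_cons_D {h : ℕ} (hh : 0 < h) (l : List ℕ) (hl : IsAreaFrom (h - 1) l) :
    pathOf h l = D :: pathOf (h - 1) l := by
  cases l with
  | nil =>
    obtain ⟨h, rfl⟩ : ∃ j, h = j + 1 := ⟨h - 1, by omega⟩
    rfl
  | cons a l =>
    have : h - a = (h - 1 - a) + 1 := by have := hl.1; omega
    rw [pathOf, pathOf, this, List.replicate_succ, List.cons_append]

theorem pathOf_heightsFrom (h : ℕ) (l : List DyckStep) (hl : IsDyckFrom h l) :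
    pathOf h (heightsFrom h l) = l := by
  induction l generalizing h with
  | nil => rw [IsDyckFrom] at hl; subst hl; rfl
  | cons s l ih =>
    cases s with
    | U => simp [heightsFrom, pathOf, ih _ hl]
    | D => rw [heightsFrom, pathOf_eq_cons_D hl.1 _ (isAreaFrom_heightsFrom _ _), ih _ hl.2]

theorem length_heightsFrom (h : ℕ) (l : List DyckStep) :
    (heightsFrom h l).length = l.count U := by
  induction l generalizing h with
  | nil => rfl
  | cons s l ih => cases s <;> simp [heightsFrom, ih]

theorem length_areaWord (π : DyckWord) : (areaWord π).length = π.semilength :=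
  length_heightsFrom _ _

/-- `pathOf 0` recovers the path, since on Dyck paths no subtraction in `heightsFrom` truncates. -/
theorem areaWord_injective : Function.Injective areaWord := by
  intro π π' h
  refine DyckWord.ext ?_
  rw [← pathOf_heightsFrom 0 _ (isDyckFrom_dyckWord π),
    ← pathOf_heightsFrom 0 _ (isDyckFrom_dyckWord π')]
  exact congrArg (pathOf 0) h

theorem exists_areaWord_eq (l : List ℕ) (hl : IsAreaFrom 0 l) : ∃ π, areaWord π = l := by
  have h := (isDyckFrom_iff _ _).1 (isDyckFrom_pathOf 0 l hl)
  exact ⟨⟨pathOf 0 l, by simpa using h.1, by simpa using h.2⟩, heightsFrom_pathOf 0 l hl⟩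

theorem isAreaFrom_iff (h : ℕ) (l : List ℕ) :
    IsAreaFrom h l ↔ (0 < l.length → l.getD 0 0 ≤ h) ∧
      ∀ i, i + 1 < l.length → l.getD (i + 1) 0 ≤ l.getD i 0 + 1 := by
  induction l generalizing h with
  | nil => simp [IsAreaFrom]
  | cons a l ih =>
    simp only [IsAreaFrom, ih, List.length_cons, Nat.zero_lt_succ, true_imp_iff,
      List.getD_cons_zero, List.getD_cons_succ]
    refine and_congr_right fun _ => ⟨fun ⟨h1, h2⟩ i hi => ?_, fun h => ⟨fun h0 => ?_, fun i hi => ?_⟩⟩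
    · cases i with
      | zero => exact h1 (by omega)
      | succ i => exact h2 i (by omega)
    · exact h 0 (by omega)
    · exact h (i + 1) (by omega)

/-! ### Decorated paths as valid lists of steps. -/

theorem isValid_map_range_iff (n : ℕ) (g : ℕ → Step) (o : Option Step) :
    IsValid o ((List.range n).map g) ↔ (0 < n → FollowsOption o (g 0)) ∧
      ∀ i, i + 1 < n → (g i).Follows (g (i + 1)) := by
  induction n generalizing g o with
  | zero => simp [IsValid]
  | succ n ih =>
    rw [List.range_succ_eq_map, List.map_cons, List.map_map, IsValid, ih]
    simp only [FollowsOption, Function.comp, Nat.succ_eq_add_one, Nat.zero_lt_succ, true_imp_iff]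
    refine and_congr_right fun _ => ⟨fun ⟨h1, h2⟩ i hi => ?_, fun h => ⟨fun h0 => ?_, fun i hi => ?_⟩⟩
    · cases i with
      | zero => exact h1 (by omega)
      | succ i => exact h2 i (by omega)
    · exact h 0 (by omega)
    · exact h (i + 1) (by omega)

theorem countP_map_range {α : Type*} (n : ℕ) (g : ℕ → α) (p : α → Prop) [DecidablePred p] :
    ((List.range n).map g).countP (fun x => p x) =
      ((Finset.range n).filter fun i => p (g i)).card := by
  induction n with
  | zero => simp
  | succ n ih =>
    rw [List.range_succ, List.map_append, List.countP_append, ih, Finset.range_add_one,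
      Finset.filter_insert]
    by_cases h : p (g n) <;> simp [h]

theorem listDinv_map_range (n : ℕ) (g : ℕ → Step) :
    listDinv ((List.range n).map g) =
      (((Finset.range n ×ˢ Finset.range n).filter
        fun e => e.1 < e.2 ∧ (g e.1).IsInv (g e.2)).card : ℤ) -
      (((Finset.range n).filter fun i => (g i).dec = true).card : ℤ) := by
  simp only [Finset.card_filter, Finset.sum_product]
  induction n generalizing g with
  | zero => simp [listDinv]
  | succ n ih =>
    -- These are the pairs whose first member is the position `0`.
    have hc := countP_map_range n (g ∘ Nat.succ) (fun y => (g 0).IsInv y)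
    rw [Finset.card_filter] at hc
    rw [List.range_succ_eq_map, List.map_cons, List.map_map, listDinv, ih, hc]
    simp only [Finset.sum_range_succ', Function.comp, Nat.succ_eq_add_one]
    simp only [Nat.add_lt_add_iff_right, Nat.not_lt_zero, false_and, if_false, add_zero,
      Nat.zero_lt_succ, true_and, Nat.cast_add, Nat.cast_sum, Nat.cast_ite, Nat.cast_one,
      Nat.cast_zero]
    ring

/-- The list of the vertical steps of a decorated path. -/
def DecoratedPath.steps (P : DecoratedPath) : List Step :=
  (List.range P.size).map fun i => ⟨areaAt P.path i, labelAt P.label i, decide (i ∈ P.dv)⟩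

namespace DecoratedPath

variable (P : DecoratedPath)

theorem map_range_getD {α : Type*} (l : List α) (a : α) :
    (List.range l.length).map (fun i => l.getD i a) = l := by
  apply List.ext_getElem <;> simp +contextual

theorem map_height_steps : P.steps.map Step.height = areaWord P.path := by
  rw [steps, List.map_map, size, ← length_areaWord]
  exact map_range_getD _ 0

theorem map_label_steps : P.steps.map Step.label = P.label := by
  rw [steps, List.map_map, size, ← P.isPartialLabelling.length_eq]
  exact map_range_getD _ 0

theorem dv_subset_range : P.dv ⊆ Finset.range P.size :=
  P.dv_subset.trans (Finset.filter_subset _ _)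

theorem steps_injective : Function.Injective steps := by
  intro P P' h
  have h1 : P.path = P'.path := areaWord_injective (by
    rw [← map_height_steps, ← map_height_steps, h])
  have h2 : P.label = P'.label := by rw [← map_label_steps, ← map_label_steps, h]
  have hs : P.size = P'.size := by rw [size, size, h1]
  refine DecoratedPath.ext h1 h2 (Finset.ext fun i => ?_)
  by_cases hi : i < P.size
  · have h3 : P.steps[i]? = P'.steps[i]? := by rw [h]
    have hi' : i < P'.size := hs ▸ hi
    simpa [steps, hi, hi', h1, h2] using h3
  -- Beyond the size the lists say nothing, but decorations are confined to the range.
  · have a1 : i ∉ P.dv := fun h => hi (by simpa using P.dv_subset_range h)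
    have a2 : i ∉ P'.dv := fun h => hi (hs ▸ by simpa using P'.dv_subset_range h)
    simp [a1, a2]

theorem isValid_steps : IsValid none P.steps := by
  obtain ⟨ha0, ha⟩ := (isAreaFrom_iff _ _).1 (isAreaFrom_heightsFrom 0 P.path.toList)
  have hlen : (heightsFrom 0 P.path.toList).length = P.size := length_areaWord P.path
  rw [hlen] at ha0 ha
  have hval : ∀ i ∈ P.dv, _ := fun i hi => (Finset.mem_filter.1 (P.dv_subset hi)).2
  refine (isValid_map_range_iff _ _ _).2 ⟨fun h => ⟨?_, ?_, ?_⟩, fun i hi => ⟨?_, ?_, ?_⟩⟩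
  · exact Nat.le_zero.1 (ha0 h)
  · exact P.isPartialLabelling.first_pos h
  · have : 0 ∉ P.dv := fun h => by have := (hval 0 h).1; omega
    simpa using this
  · exact ha i hi
  · exact P.isPartialLabelling.column_lt i hi
  · intro h
    exact (hval (i + 1) (by simpa using h)).2

theorem exists_steps_eq {l : List Step} (hl : IsValid none l) :
    ∃ P : DecoratedPath, P.steps = l := by
  -- The default step has height and label `0`, which agrees with the defaults in `areaAt` and
  -- `labelAt`.
  have hl' : (List.range l.length).map (fun i => l.getD i ⟨0, 0, false⟩) = l := map_range_getD _ _
  have hv := hl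
  rw [← hl', isValid_map_range_iff] at hv
  obtain ⟨hv0, hv⟩ := hv
  have e1 : ∀ i, (l.map Step.height).getD i 0 = (l.getD i ⟨0, 0, false⟩).height := fun i =>
    List.getD_map (f := Step.height) (d := ⟨0, 0, false⟩) ..
  have e2 : ∀ i, (l.map Step.label).getD i 0 = (l.getD i ⟨0, 0, false⟩).label := fun i =>
    List.getD_map (f := Step.label) (d := ⟨0, 0, false⟩) ..
  obtain ⟨π, hπ⟩ := exists_areaWord_eq (l.map Step.height) (by
    rw [isAreaFrom_iff]
    simp only [e1, List.length_map]
    exact ⟨fun h => (hv0 h).1.le, fun i hi => (hv i hi).1⟩)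
  have hlen : π.semilength = l.length := by rw [← length_areaWord, hπ, List.length_map]
  have ea : ∀ i, areaAt π i = (l.getD i ⟨0, 0, false⟩).height := fun i => by
    rw [areaAt, hπ, e1]
  have el : ∀ i, labelAt (l.map Step.label) i = (l.getD i ⟨0, 0, false⟩).label := fun i => by
    rw [labelAt, e2]
  refine ⟨⟨π, l.map Step.label,
    (Finset.range l.length).filter fun i => (l.getD i ⟨0, 0, false⟩).dec = true,
    ⟨by simp [hlen], ?_, ?_⟩, ?_⟩, ?_⟩
  · intro i hi h
    rw [el, el]
    rw [ea, ea] at h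
    exact (hv i (hlen ▸ hi)).2.1 h
  · intro h
    rw [el]
    exact (hv0 (hlen ▸ h)).2.1
  · intro i hi
    obtain ⟨hi, hd⟩ := Finset.mem_filter.1 hi
    rw [contractibleValleys, Finset.mem_filter, hlen]
    refine ⟨hi, ?_⟩
    rw [Finset.mem_range] at hi
    cases i with
    | zero => rw [(hv0 hi).2.2] at hd; cases hd
    | succ i =>
      simp only [ea, el, Nat.add_sub_cancel]
      exact ⟨by omega, (hv i hi).2.2 hd⟩
  · conv_rhs => rw [← hl']
    rw [steps, size]
    simp only [hlen]
    refine List.map_congr_left fun i hi => ?_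
    rw [List.mem_range] at hi
    ext1
    · exact ea i
    · exact el i
    · simp [hi]

theorem listDinv_steps : listDinv P.steps = P.dinv := by
  rw [steps, listDinv_map_range, dinv]
  congr 3
  · ext e
    rw [Finset.mem_filter, Finset.mem_filter]
    simp [IsInv, IsDiagInv]
  · ext i
    have := fun h : i ∈ P.dv => P.dv_subset_range h
    simp at this ⊢
    exact this

theorem listTouch_steps : listTouch P.steps = P.touch := by
  rw [steps, listTouch, countP_map_range, touch]
  simp [IsTouch]

theorem listDec_steps : listDec P.steps = P.dv.card := by
  have h := countP_map_range P.size
    (fun i => (⟨areaAt P.path i, labelAt P.label i, decide (i ∈ P.dv)⟩ : Step))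
    (fun x => x.dec = true)
  simp only [Bool.decide_eq_true] at h
  rw [steps, listDec, h]
  congr 1
  ext i
  have := fun h : i ∈ P.dv => P.dv_subset_range h
  simp at this ⊢
  exact this

theorem listArea_steps : listArea P.steps = P.area := by
  rw [listArea, map_height_steps, area]

theorem listZero_steps : listZero P.steps = P.numZero := by
  rw [numZero, ← map_label_steps, List.countP_map]; rfl

theorem listPos_steps : listPos P.steps = P.numPos := by
  rw [numPos, ← map_label_steps, List.countP_map]; rfl

theorem listExp_steps : listExp P.steps = P.xExp := by
  rw [listExp, map_label_steps, xExp]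

end DecoratedPath

/-! ### Coefficients as sums over lists, and the final count. -/

/-- The step lists of the paths that are summed in `maxSeries`. -/
def maxLists (m n k r M : ℕ) (d : ℕ →₀ ℕ) : Set (List Step) :=
  {K | IsValid none K ∧ LabelsIn M K ∧ K.length = n ∧ listDec K = k ∧ listTouch K = r ∧
    (K.countP fun x => x.label = M) = m ∧ (listExp K).erase M = d}

/-- The step lists of the paths that are summed in `ldSeries`. -/
def ldLists (m n k r : ℤ) (d : ℕ →₀ ℕ) : Set (List Step) :=
  {L | IsValid none L ∧ (listZero L : ℤ) = m ∧ (listPos L : ℤ) = n ∧ (listDec L : ℤ) = k ∧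
    (listTouch L : ℤ) = r ∧ listExp L = d}

theorem bijOn_steps_maxLists (m n k r M : ℕ) (d : ℕ →₀ ℕ) :
    Set.BijOn DecoratedPath.steps {P : DecoratedPath | P ∈ LD 0 n k ∧ P.touch = r ∧
      P.HasMaxLabels M m ∧ P.xExp.erase M = d} (maxLists m n k r M d) := by
  have key : ∀ P : DecoratedPath, (P ∈ LD 0 n k ∧ P.touch = r ∧
      P.HasMaxLabels M m ∧ P.xExp.erase M = d) ↔ P.steps ∈ maxLists m n k r M d := by
    intro P
    have h1 := numZero_add_numPos P
    have h2 : P.numZero = 0 ↔ ∀ x ∈ P.label, 0 < x := by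
      simp [DecoratedPath.numZero, List.countP_eq_zero, Nat.pos_iff_ne_zero]
    have h3 : LabelsIn M P.steps ↔ ∀ x ∈ P.label, 0 < x ∧ x ≤ M := by
      rw [← P.map_label_steps, LabelsIn, List.forall_mem_map]
    have h4 : (P.steps.countP fun x => x.label = M) = P.label.count M := by
      rw [← P.map_label_steps, List.count, List.countP_map]
      rfl
    have h5 : P.steps.length = P.label.length := by rw [← P.map_label_steps, List.length_map]
    simp only [LD, maxLists, Set.mem_ofPred_eq, DecoratedPath.HasMaxLabels, P.isValid_steps,
      P.listDec_steps, P.listTouch_steps, P.listExp_steps, h3, h4, h5, true_and]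
    constructor
    · rintro ⟨⟨a1, a2, a3⟩, a4, ⟨a5, a6⟩, a7⟩
      have h0 := h2.1 (by omega)
      exact ⟨fun x hx => ⟨h0 x hx, a5 x hx⟩, by omega, by omega, a4, a6, a7⟩
    · rintro ⟨a1, a2, a3, a4, a5, a6⟩
      have h0 := h2.2 fun x hx => (a1 x hx).1
      exact ⟨⟨by omega, by omega, by omega⟩, a4, ⟨fun x hx => (a1 x hx).2, a5⟩, a6⟩
  refine ⟨fun P hP => (key P).1 hP, DecoratedPath.steps_injective.injOn, fun K hK => ?_⟩
  obtain ⟨P, rfl⟩ := DecoratedPath.exists_steps_eq hK.1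
  exact ⟨P, (key P).2 hK, rfl⟩

theorem bijOn_steps_ldLists (m n k r : ℤ) (d : ℕ →₀ ℕ) :
    Set.BijOn DecoratedPath.steps {P : DecoratedPath | P ∈ LD m n k ∧ (P.touch : ℤ) = r ∧
      P.xExp = d} (ldLists m n k r d) := by
  have key : ∀ P : DecoratedPath, (P ∈ LD m n k ∧ (P.touch : ℤ) = r ∧ P.xExp = d) ↔
      P.steps ∈ ldLists m n k r d := by
    intro P
    simp only [LD, ldLists, Set.mem_ofPred_eq, P.isValid_steps, P.listZero_steps, P.listPos_steps,
      P.listDec_steps, P.listTouch_steps, P.listExp_steps, true_and, and_assoc]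
  refine ⟨fun P hP => (key P).1 hP, DecoratedPath.steps_injective.injOn, fun K hK => ?_⟩
  obtain ⟨P, rfl⟩ := DecoratedPath.exists_steps_eq hK.1
  exact ⟨P, (key P).2 hK, rfl⟩

theorem finite_maxLists (m n k r M : ℕ) (d : ℕ →₀ ℕ) : (maxLists m n k r M d).Finite := by
  rw [← (bijOn_steps_maxLists m n k r M d).image_eq]
  exact (maxSeries_finite m n k r M d).image _

theorem finite_ldLists (m n k r : ℤ) (d : ℕ →₀ ℕ) : (ldLists m n k r d).Finite := by
  rw [← (bijOn_steps_ldLists m n k r d).image_eq]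
  exact (ldSeries_finite m n k r d).image _

/-- The weight of a list of steps. -/
noncomputable def listWeight (K : List Step) : QT := q ^ listDinv K * t ^ listArea K

theorem coeff_maxSeries (m n k r M : ℕ) (d : ℕ →₀ ℕ) :
    MvPowerSeries.coeff d (maxSeries m n k r M) =
      ∑ K ∈ (finite_maxLists m n k r M d).toFinset, listWeight K := by
  rw [← finsum_mem_eq_finite_toFinset_sum]
  refine finsum_mem_eq_of_bijOn _ (bijOn_steps_maxLists m n k r M d) fun P _ => ?_
  rw [listWeight, P.listDinv_steps, P.listArea_steps]

theorem coeff_ldSeries (m n k r : ℤ) (d : ℕ →₀ ℕ) :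
    MvPowerSeries.coeff d (ldSeries m n k r) =
      ∑ L ∈ (finite_ldLists m n k r d).toFinset, listWeight L := by
  rw [← finsum_mem_eq_finite_toFinset_sum]
  refine finsum_mem_eq_of_bijOn _ (bijOn_steps_ldLists m n k r d) fun P _ => ?_
  rw [listWeight, P.listDinv_steps, P.listArea_steps]

/-- Labels below `M` are what makes `pull M` a right inverse of `push M`, as the fibre count needs.
-/
theorem label_lt_of_listExp {M : ℕ} (hM : 0 < M) (L : List Step)
    (h : ∀ j ∈ (listExp L).support, j < M) : ∀ x ∈ L, x.label < M := by
  intro x hx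
  rcases Nat.eq_zero_or_pos x.label with h0 | h0
  · omega
  · refine h _ ?_
    simp only [listExp, Multiset.toFinsupp_support, Multiset.mem_toFinset, Multiset.mem_coe,
      List.mem_filter, List.mem_map]
    exact ⟨⟨x, hx, rfl⟩, by simpa using h0⟩

theorem sum_fibre (m n k r M p i : ℕ) (hM : 0 < M) (d : ℕ →₀ ℕ) (hd : ∀ j ∈ d.support, j < M)
    (hi : i ≤ p) (L : List Step)
    (hL : L ∈ ldLists ((m : ℤ) - p) ((n : ℤ) - m) ((k : ℤ) - i) ((r : ℤ) - p + i) d) :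
    ∑ K ∈ (finite_maxLists m n k r M d).toFinset with
      (plainBottoms M K + decBottoms M K = p ∧ decBottoms M K = i) ∧ pushList M K = L,
        listWeight K =
      t ^ (m - p) * ((q ^ (Nat.choose i 2) * qBinom ((r : ℤ) - p + i) i *
        qBinom r ((p : ℤ) - i)) * listWeight L) := by
  obtain ⟨b1, b2, b3, b4, b5, b6⟩ := hL
  obtain ⟨S, hS, hv⟩ := fibreSum_eq hM L (label_lt_of_listExp hM L (by rwa [b6])) b1 (p - i) i
  have hset : (finite_maxLists m n k r M d).toFinset.filter (fun K =>
      (plainBottoms M K + decBottoms M K = p ∧ decBottoms M K = i) ∧ pushList M K = L) = S := by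
    ext K
    rw [Finset.mem_filter, Set.Finite.mem_toFinset, hS]
    constructor
    · rintro ⟨⟨a1, a2, -⟩, ⟨a3, a4⟩, a5⟩
      exact ⟨a2, a5, ((isValid_none_iff K a2).1 a1).2, by omega, a4⟩
    · rintro ⟨a1, a2, a3, a4, a5⟩
      -- The statistics of `K` are those of `L` shifted by `p` and `i`, so membership is arithmetic.
      have e1 := listTouch_pushList K a1
      have e2 := listDec_pushList (M := M) K
      have e3 := listZero_pushList K a1
      have e4 := listPos_pushList K a1
      have e5 := listExp_pushList K a1
      rw [a2] at e1 e2 e3 e4 e5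
      refine ⟨⟨(isValid_none_iff K a1).2 ⟨by rwa [a2], a3⟩, a1, ?_, ?_, ?_, ?_, ?_⟩,
        ⟨?_, a5⟩, a2⟩
      any_goals omega
      rw [← e5, b6]
  have hw : ∀ K ∈ S, listWeight K = (t ^ (m - p) * listWeight L) * q ^ bottomDinv M 0 K := by
    intro K hK
    obtain ⟨a1, a2, a3, a4, a5⟩ := (hS K).1 hK
    have e1 := listDinv_eq K a1 0
    have e2 := listArea_pushList (M := M) K
    have e3 := listZero_pushList K a1
    rw [a2] at e1 e2 e3
    -- Each of the `m - p` labels `M` off the main diagonal drops by one diagonal.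
    have e4 : listArea K = listArea L + (m - p) := by omega
    rw [listWeight, listWeight, e1, e4, Nat.cast_zero, zero_mul, sub_zero, zpow_add₀ q_ne_zero,
      pow_add]
    ring
  have q1 : qBinom ((r : ℤ) - p + i) i = gaussBinom (listTouch L) i := by
    rw [← b5, qBinom_natCast]
  -- Here `r` is the touch of `L` plus the `p - i` undecorated bottoms.
  have q2 : qBinom r ((p : ℤ) - i) = gaussBinom (listTouch L + (p - i)) (p - i) := by
    rw [← qBinom_natCast]
    congr 1 <;> omega
  rw [hset, Finset.sum_congr rfl hw, ← Finset.mul_sum, hv, q1, q2]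
  ring

theorem pushList_mem_ldLists {m n k r M : ℕ} {d : ℕ →₀ ℕ} {K : List Step}
    (hK : K ∈ maxLists m n k r M d) :
    pushList M K ∈ ldLists ((m : ℤ) - (plainBottoms M K + decBottoms M K : ℕ)) ((n : ℤ) - m)
      ((k : ℤ) - decBottoms M K)
      ((r : ℤ) - (plainBottoms M K + decBottoms M K : ℕ) + decBottoms M K) d := by
  obtain ⟨a1, a2, a3, a4, a5, a6, a7⟩ := hK
  have e1 := listTouch_pushList K a2
  have e2 := listDec_pushList (M := M) K
  have e3 := listZero_pushList K a2
  have e4 := listPos_pushList K a2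
  refine ⟨((isValid_none_iff K a2).1 a1).1, ?_, ?_, ?_, ?_, (listExp_pushList K a2).trans a7⟩ <;>
    omega

end Pushing

/-- The maximal label is called `M`, and the monomials considered are those in the variables of
the smaller labels; as `M` is arbitrary, every coefficient is covered. -/
theorem mainTheorem2 (m n k r M : ℕ) (hM : 0 < M)
    (d : ℕ →₀ ℕ) (hd : ∀ j ∈ d.support, j < M) :
    MvPowerSeries.coeff d (Pushing.maxSeries m n k r M) =
      MvPowerSeries.coeff d
        (∑ p ∈ Finset.range (m + 1), Pushing.t ^ (m - p) •
          ∑ i ∈ Finset.range (p + 1),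
            (Pushing.q ^ (Nat.choose i 2) *
              Pushing.qBinom ((r : ℤ) - p + i) i * Pushing.qBinom r ((p : ℤ) - i)) •
            Pushing.ldSeries ((m : ℤ) - p) ((n : ℤ) - m) ((k : ℤ) - i) ((r : ℤ) - p + i)) := by
  open Pushing in
  simp only [map_sum, MvPowerSeries.coeff_smul, coeff_maxSeries, coeff_ldSeries, Finset.mul_sum]
  -- The sum is split by the number `p` of bottoms, then by the number `i` of decorated ones, then
  -- by the pushed list; what is left is `sum_fibre`.
  rw [← Finset.sum_fiberwise_of_maps_to (t := Finset.range (m + 1))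
    (g := fun K => plainBottoms M K + decBottoms M K)]
  · refine Finset.sum_congr rfl fun p _ => ?_
    rw [← Finset.sum_fiberwise_of_maps_to (t := Finset.range (p + 1)) (g := decBottoms M)]
    · refine Finset.sum_congr rfl fun i hi => ?_
      rw [Finset.filter_filter, ← Finset.sum_fiberwise_of_maps_to (g := pushList M)
        (t := (finite_ldLists ((m : ℤ) - p) ((n : ℤ) - m) ((k : ℤ) - i)
          ((r : ℤ) - p + i) d).toFinset)]
      · refine Finset.sum_congr rfl fun L hL => ?_
        rw [Finset.filter_filter]
        rw [Finset.mem_range] at hi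
        exact sum_fibre m n k r M p i hM d hd (by omega) L (by simpa using hL)
      · intro K hK
        rw [Finset.mem_filter, Set.Finite.mem_toFinset] at hK
        obtain ⟨h1, rfl, rfl⟩ := hK
        rw [Set.Finite.mem_toFinset]
        exact pushList_mem_ldLists h1
    · intro K hK
      rw [Finset.mem_filter] at hK
      rw [Finset.mem_range]
      omega
  · intro K hK
    rw [Set.Finite.mem_toFinset] at hK
    have := (listArea_pushList (M := M) K).2
    have := hK.2.2.2.2.2.1
    rw [Finset.mem_range]
    omega
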